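/- Let $\alpha_i,\beta_i,\gamma_i\in\mathbb{C}$ ($i=0,1,2$) with $(\gamma_1,\gamma_2)\neq(0,0)$ and suppose that $$f(x,y)=\left(\alpha_0+\alpha_1x+\alpha_2y,\ \frac{\beta_0+\beta_1x+\beta_2y}{\gamma_0+\gamma_1x+\gamma_2y}\right)$$ is birational, i.e. there are a rational map $g$ of $\mathbb{C}^2$ and an algebraic curve $V\subset\mathbb{C}^2$ such that $f\circ g=g\circ f=\mathrm{id}$ on $\mathbb{C}^2\setminus V$. Assume $\alpha_1\gamma_2-\alpha_2\gamma_1=0$. Let $F:\mathbb{P}^2\dashrightarrow\mathbb{P}^2$ be the extension of $f$ under $(x_1,x_2)\mapsto[1:x_1:x_2]$, that is, $$F[x_0:x_1:x_2]=\big[x_0\,\ell_\gamma:\ \ell_\alpha\,\ell_\gamma:\ x_0\,\ell_\beta\big],\qquad \ell_\epsilon=\epsilon_0x_0+\epsilon_1x_1+\epsilon_2x_2 .$$ For $n\ge 0$ let $d_n=\deg(F^n)$ be the common degree of the homogeneous components of the iterate $F^n$ after removal of all common factors (so $d_0=1$), and let $\delta(F)=\lim_{n\to\infty}d_n^{1/n}$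 be the dynamical degree. Then the following hold, where in each case the limit $\delta(F)$ exists. (i) If $\alpha_1,\alpha_2,\gamma_1,\gamma_2$ are all nonzero, then $\delta(F)=2$ and $d_n=2^n$ for all $n\ge 0$. (ii) If $\alpha_1=\gamma_1=0$, then $\delta(F)=\frac{1+\sqrt5}{2}$ and $d_{n+2}=d_{n+1}+d_n$ for all $n\ge 0$. (iii) If $\alpha_2=\gamma_2=0$, then $\delta(F)=1$ and $d_n=n+1$ for all $n\ge 0$. -/

import Mathlib

open Filter Topology MvPolynomial

/-- A pair of fractions `(num 0 / den 0, num 1 / den 1)` of complex polynomials in two variables,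
written as a map of the affine plane `ℂ²` with rational components. -/
structure PlaneRatMap where
  num : Fin 2 → MvPolynomial (Fin 2) ℂ
  den : Fin 2 → MvPolynomial (Fin 2) ℂ

namespace PlaneRatMap

/-- No denominator vanishes at `z`. -/
def DefinedAt (f : PlaneRatMap) (z : Fin 2 → ℂ) : Prop :=
  ∀ i, eval z (f.den i) ≠ 0

/-- The value at `z`, meaningful where `f` is defined. -/
noncomputable def toFun (f : PlaneRatMap) (z : Fin 2 → ℂ) : Fin 2 → ℂ :=
  fun i => eval z (f.num i) / eval z (f.den i)

/-- `f` is birational: there are a rational map `g` and an algebraic curve `{v = 0}`, `v ≠ 0`,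
such that outside that curve `g ∘ f` and `f ∘ g` are defined and equal to the identity.
(In particular the denominators of `f` and `g` are then nonzero polynomials.) -/
def IsBirational (f : PlaneRatMap) : Prop :=
  ∃ (g : PlaneRatMap) (v : MvPolynomial (Fin 2) ℂ), v ≠ 0 ∧
    ∀ z : Fin 2 → ℂ, eval z v ≠ 0 →
      (f.DefinedAt z ∧ g.DefinedAt (f.toFun z) ∧ g.toFun (f.toFun z) = z) ∧
      (g.DefinedAt z ∧ f.DefinedAt (g.toFun z) ∧ f.toFun (g.toFun z) = z)

end PlaneRatMap

/-- The map `f(x,y) = (α₀ + α₁ x + α₂ y, (β₀ + β₁ x + β₂ y) / (γ₀ + γ₁ x + γ₂ y))`,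
with `x = X 0` and `y = X 1`. -/
noncomputable def affineMap (α β γ : Fin 3 → ℂ) : PlaneRatMap where
  num := ![C (α 0) + C (α 1) * X 0 + C (α 2) * X 1, C (β 0) + C (β 1) * X 0 + C (β 2) * X 1]
  den := ![1, C (γ 0) + C (γ 1) * X 0 + C (γ 2) * X 1]

/-- A triple of polynomials in `x₀, x₁, x₂`, as homogeneous coordinates of a map of `ℙ²`. -/
abbrev PolyTriple := Fin 3 → MvPolynomial (Fin 3) ℂ

/-- The linear form `a₀ x₀ + a₁ x₁ + a₂ x₂`. -/
noncomputable def linForm (a : Fin 3 → ℂ) : MvPolynomial (Fin 3) ℂ :=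
  C (a 0) * X 0 + C (a 1) * X 1 + C (a 2) * X 2

/-- The extension `F` of `affineMap α β γ` to `ℙ²`, for the embedding `(x, y) ↦ [1 : x : y]`. -/
noncomputable def projMap (α β γ : Fin 3 → ℂ) : PolyTriple :=
  ![X 0 * linForm γ, linForm α * linForm γ, X 0 * linForm β]

namespace PolyTriple

/-- Composition of triples: substitute `Q` into `P`. -/
noncomputable def comp (P Q : PolyTriple) : PolyTriple :=
  fun i => bind₁ Q (P i)

/-- The `n`-fold composition `P ∘ ⋯ ∘ P`, common factors not yet removed. -/
noncomputable def iter (P : PolyTriple) : ℕ → PolyTriple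
  | 0 => fun i => X i
  | n + 1 => comp P (iter P n)

/-- The rational map of `ℙ²` given by the triple `P` has degree `k`: after division by a common
factor `H` the components of `P` are homogeneous of degree `k` without a nonconstant common
factor. -/
def HasDegree (P : PolyTriple) (k : ℕ) : Prop :=
  ∃ (H : MvPolynomial (Fin 3) ℂ) (Q : PolyTriple), H ≠ 0 ∧
    (∀ i, P i = H * Q i) ∧
    (∀ i, (Q i).IsHomogeneous k) ∧
    (∀ R : MvPolynomial (Fin 3) ℂ, (∀ i, R ∣ Q i) → IsUnit R)

/-- `d` is the sequence of degrees of the iterates of `P`: for each `n` the iterate `Pⁿ` has the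
degree `d n`, and no other. -/
def IsDegreeSequence (P : PolyTriple) (d : ℕ → ℕ) : Prop :=
  ∀ n k, HasDegree (iter P n) k ↔ k = d n

/-- `δ` is the dynamical degree of `P`: the limit of `(deg Pⁿ)^(1/n)`. -/
def IsDynamicalDegree (P : PolyTriple) (δ : ℝ) : Prop :=
  ∃ d : ℕ → ℕ, IsDegreeSequence P d ∧
    Tendsto (fun n : ℕ => (d n : ℝ) ^ ((1 : ℝ) / (n : ℝ))) atTop (𝓝 δ)

end PolyTriple

/-! The degree of `F^n` falls below `2^n` exactly when some curve is carried into an indeterminacy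
point of `F`. Birationality forces `α 1 * β 2 - α 2 * β 1 ≠ 0`; since the linear parts of `α` and
`γ` are parallel, `F` then contracts only `x₀ = 0`, to `[0:1:0]`, and `ℓ_γ = 0`, to `[0:0:1]`. So no
iterate contracts a curve to an affine point (`AvoidsAffinePoints.step`), and cancellation can occur
only through the indeterminacy point `q = [0:γ₂:-γ₁]` at infinity.

If all four coefficients are nonzero, `q` is neither `[0:1:0]` nor `[0:0:1]`. The former is fixed
and the latter maps to it, so nothing ever cancels. If `α₁ = γ₁ = 0`, then `q = [0:1:0]`, the image
of the line at infinity; if `α₂ = γ₂ = 0`, then `q = [0:0:1]`, the image of `ℓ_γ = 0`. In these two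
cases the iterates are written down with the common factor removed, and coprimality is checked
modulo each prime `p`. -/

/-- The linear form with coefficients `a`, evaluated on a triple of polynomials. -/
noncomputable def linEval (a : Fin 3 → ℂ) (T : PolyTriple) : MvPolynomial (Fin 3) ℂ :=
  C (a 0) * T 0 + C (a 1) * T 1 + C (a 2) * T 2

theorem bind₁_linForm (a : Fin 3 → ℂ) (T : PolyTriple) :
    bind₁ T (linForm a) = linEval a T := by
  simp [linForm, linEval]

theorem linEval_smul (a : Fin 3 → ℂ) (H : MvPolynomial (Fin 3) ℂ) (T : PolyTriple) :
    linEval a (fun i => H * T i) = H * linEval a T := by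
  simp only [linEval]; ring

theorem comp_projMap (α β γ : Fin 3 → ℂ) (T : PolyTriple) :
    PolyTriple.comp (projMap α β γ) T =
      ![T 0 * linEval γ T, linEval α T * linEval γ T, T 0 * linEval β T] := by
  funext i
  fin_cases i <;> simp [PolyTriple.comp, projMap, bind₁_linForm]

theorem comp_projMap_smul (α β γ : Fin 3 → ℂ) (H : MvPolynomial (Fin 3) ℂ) (T : PolyTriple)
    (i : Fin 3) :
    PolyTriple.comp (projMap α β γ) (fun i => H * T i) i =
      H ^ 2 * PolyTriple.comp (projMap α β γ) T i := by
  fin_cases i <;> simp [comp_projMap, linEval_smul] <;> ring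

theorem isHomogeneous_C_mul {p : MvPolynomial (Fin 3) ℂ} {k : ℕ} (hp : p.IsHomogeneous k)
    (c : ℂ) : (C c * p).IsHomogeneous k := by
  simpa using (isHomogeneous_C (Fin 3) c).mul hp

theorem isHomogeneous_linEval {T : PolyTriple} {k : ℕ} (hT : ∀ i, (T i).IsHomogeneous k)
    (a : Fin 3 → ℂ) : (linEval a T).IsHomogeneous k :=
  ((isHomogeneous_C_mul (hT 0) _).add (isHomogeneous_C_mul (hT 1) _)).add
    (isHomogeneous_C_mul (hT 2) _)

theorem dvd_of_dvd_C_mul {p q : MvPolynomial (Fin 3) ℂ} {c : ℂ} (hc : c ≠ 0)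
    (h : p ∣ C c * q) : p ∣ q := by
  have := h.mul_left (C c⁻¹)
  rwa [← mul_assoc, ← C_mul, inv_mul_cancel₀ hc, C_1, one_mul] at this

theorem Prime.associated_X {p : MvPolynomial (Fin 3) ℂ} (hp : Prime p) {i : Fin 3}
    (hi : p ∣ X i) : Associated p (X i) :=
  (hp.irreducible.dvd_irreducible_iff_associated (X_prime (i := i)).irreducible).1 hi

theorem Prime.dvd_X_unique {p : MvPolynomial (Fin 3) ℂ} (hp : Prime p) {i j : Fin 3}
    (hi : p ∣ X i) (hj : p ∣ X j) : i = j :=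
  X_dvd_X.1 ((hp.associated_X hi).symm.dvd.trans hj)

/-! ### Contracted curves never land at affine points -/

/-- The rational map given by `T` contracts no curve to a point of the affine chart:
modulo a prime, `T` is not a constant point `[1 : s : t]`. -/
def AvoidsAffinePoints (T : PolyTriple) : Prop :=
  ∀ p, Prime p → ∀ s t : ℂ, p ∣ T 1 - C s * T 0 → p ∣ T 2 - C t * T 0 → p ∣ T 0

theorem avoidsAffinePoints_X : AvoidsAffinePoints (fun i => X i) := by
  intro p hp s t h1 h2
  exfalso
  -- A linear change of coordinates moves `[1:s:t]` to `[1:0:0]`, where `p` would divide both `X 1`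
  -- and `X 2`.
  let φ : MvPolynomial (Fin 3) ℂ →ₐ[ℂ] MvPolynomial (Fin 3) ℂ :=
    aeval ![X 0, X 1 + C s * X 0, X 2 + C t * X 0]
  let ψ : MvPolynomial (Fin 3) ℂ →ₐ[ℂ] MvPolynomial (Fin 3) ℂ :=
    aeval ![X 0, X 1 - C s * X 0, X 2 - C t * X 0]
  have hψφ : ψ.comp φ = AlgHom.id ℂ _ := by
    ext i : 1
    fin_cases i <;> simp [φ, ψ, algHom_C, MvPolynomial.algebraMap_eq]
  have hφψ : φ.comp ψ = AlgHom.id ℂ _ := by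
    ext i : 1
    fin_cases i <;> simp [φ, ψ, algHom_C, MvPolynomial.algebraMap_eq]
  let e := AlgEquiv.ofAlgHom φ ψ hφψ hψφ
  have hq : Prime (e p) := (MulEquiv.prime_iff e).2 hp
  have h1' : e p ∣ X 1 := by
    have := map_dvd φ h1
    simpa [e, φ, algHom_C, MvPolynomial.algebraMap_eq] using this
  have h2' : e p ∣ X 2 := by
    have := map_dvd φ h2
    simpa [e, φ, algHom_C, MvPolynomial.algebraMap_eq] using this
  exact absurd (hq.dvd_X_unique h1' h2') (by decide)

theorem dvd_sub_C_div_mul {p A B : MvPolynomial (Fin 3) ℂ} {k u : ℂ} (hk : k ≠ 0)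
    (h : p ∣ C k * B - C u * A) : p ∣ B - C (u / k) * A := by
  apply dvd_of_dvd_C_mul hk
  have : (C u : MvPolynomial (Fin 3) ℂ) = C k * C (u / k) := by
    rw [← C_mul, mul_div_cancel₀ _ hk]
  rw [this] at h
  convert h using 1
  ring

/-- By Cramer's rule two lines with independent linear parts meet in a single affine point, so `T`
would be constant there modulo `p`. -/
theorem AvoidsAffinePoints.dvd_of_dvd_linEval {T : PolyTriple} (hT : AvoidsAffinePoints T)
    {a b : Fin 3 → ℂ} (hab : a 1 * b 2 - a 2 * b 1 ≠ 0) {p : MvPolynomial (Fin 3) ℂ}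
    (hp : Prime p) (ha : p ∣ linEval a T) (hb : p ∣ linEval b T) : p ∣ T 0 := by
  refine hT p hp ((a 2 * b 0 - b 2 * a 0) / (a 1 * b 2 - a 2 * b 1))
    ((b 1 * a 0 - a 1 * b 0) / (a 1 * b 2 - a 2 * b 1))
    (dvd_sub_C_div_mul hab ?_) (dvd_sub_C_div_mul hab ?_)
  · convert (ha.mul_left (C (b 2))).sub (hb.mul_left (C (a 2))) using 1
    simp only [linEval, C_mul, C_sub]; ring
  · convert (hb.mul_left (C (a 1))).sub (ha.mul_left (C (b 1))) using 1
    simp only [linEval, C_mul, C_sub]; ring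

/-- An affine value `[1:s:t]` of `F ∘ T` imposes `ℓ_α = s x₀` and `ℓ_β = t ℓ_γ` on `T`. As `α` and
`γ` are parallel, the determinant of this system does not depend on `t`, so `T` would already be
constant. The condition on `h` ensures that cancelling it only affects curves sent to infinity. -/
theorem AvoidsAffinePoints.step {α β γ : Fin 3 → ℂ} (hαγ : α 1 * γ 2 - α 2 * γ 1 = 0)
    (hαβ : α 1 * β 2 - α 2 * β 1 ≠ 0) {T T' : PolyTriple} {h : MvPolynomial (Fin 3) ℂ}
    (hT : AvoidsAffinePoints T)
    (hcomp : PolyTriple.comp (projMap α β γ) T = fun i => h * T' i)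
    (hdvd : h ∣ T' 0) : AvoidsAffinePoints T' := by
  intro p hp s t h1 h2
  by_contra hp0
  have hph : ¬ p ∣ h := fun H => hp0 (H.trans hdvd)
  rw [comp_projMap] at hcomp
  have e0 : T 0 * linEval γ T = h * T' 0 := congrFun hcomp 0
  have e1 : linEval α T * linEval γ T = h * T' 1 := congrFun hcomp 1
  have e2 : T 0 * linEval β T = h * T' 2 := congrFun hcomp 2
  have hn : ¬ p ∣ T 0 * linEval γ T := by
    rw [e0]; exact fun H => (hp.dvd_or_dvd H).elim hph hp0
  have hn0 : ¬ p ∣ T 0 := fun H => hn (H.mul_right _)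
  have hnγ : ¬ p ∣ linEval γ T := fun H => hn (H.mul_left _)
  have d1 : p ∣ linEval γ T * linEval ![α 0 - s, α 1, α 2] T := by
    convert h1.mul_left h using 1
    rw [mul_sub, ← e1, mul_left_comm, ← e0]
    simp [linEval]; ring
  have d2 : p ∣ T 0 * linEval (fun i => β i - t * γ i) T := by
    convert h2.mul_left h using 1
    rw [mul_sub, ← e2, mul_left_comm, ← e0]
    simp [linEval]; ring
  refine hn0 (hT.dvd_of_dvd_linEval ?_ hp ((hp.dvd_or_dvd d1).resolve_left hnγ)
    ((hp.dvd_or_dvd d2).resolve_left hn0))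
  convert hαβ using 1
  simp
  linear_combination (-t) * hαγ

/-! ### Degrees from reduced representatives -/

theorem isUnit_of_forall_prime_not_dvd {Q : PolyTriple}
    (hQ : ∀ p, Prime p → ¬ ∀ i, p ∣ Q i) {R : MvPolynomial (Fin 3) ℂ} (hR : ∀ i, R ∣ Q i) :
    IsUnit R := by
  by_contra hu
  have hR0 : R ≠ 0 := by
    rintro rfl
    exact hQ (X 0) X_prime fun i => by rw [zero_dvd_iff.1 (hR i)]; exact dvd_zero _
  obtain ⟨p, hp, hpR⟩ := WfDvdMonoid.exists_irreducible_factor hu hR0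
  exact hQ p hp.prime fun i => hpR.trans (hR i)

theorem PolyTriple.HasDegree.unique {P : PolyTriple} {k l : ℕ} (hk : P.HasDegree k)
    (hl : P.HasDegree l) : k = l := by
  obtain ⟨H, Q, hH, hPQ, hQ, hQu⟩ := hk
  obtain ⟨H', Q', hH', hPQ', hQ', hQu'⟩ := hl
  obtain ⟨a, b, g, hab, rfl, rfl⟩ : ∃ a b g, IsRelPrime a b ∧ g * a = H ∧ g * b = H' := by
    obtain ⟨a, b, g, hab, h1, h2⟩ := UniqueFactorizationMonoid.exists_reduced_factors H hH H'
    exact ⟨a, b, g, fun _ => @hab _, h1, h2⟩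
  have hg : g ≠ 0 := left_ne_zero_of_mul hH
  have key : ∀ i, a * Q i = b * Q' i := fun i =>
    mul_left_cancel₀ hg (by rw [← mul_assoc, ← mul_assoc, ← hPQ, ← hPQ'])
  have ha : IsUnit a := hQu' a fun i => hab.dvd_of_dvd_mul_left ⟨Q i, (key i).symm⟩
  have hb : IsUnit b := hQu b fun i => hab.symm.dvd_of_dvd_mul_left ⟨Q' i, key i⟩
  obtain ⟨i, hi⟩ : ∃ i, Q i ≠ 0 := by
    by_contra! h
    exact (X_prime (R := ℂ) (i := (0 : Fin 3))).not_isUnit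
      (hQu _ fun i => by rw [h]; exact dvd_zero _)
  have hi' : b * Q' i ≠ 0 := key i ▸ mul_ne_zero ha.ne_zero hi
  have hdeg := congrArg totalDegree (key i)
  rwa [totalDegree_mul_of_isDomain ha.ne_zero hi,
    totalDegree_mul_of_isDomain hb.ne_zero (right_ne_zero_of_mul hi'),
    (isUnit_iff_totalDegree_of_isReduced.1 ha).2, (isUnit_iff_totalDegree_of_isReduced.1 hb).2,
    (hQ i).totalDegree hi, (hQ' i).totalDegree (right_ne_zero_of_mul hi'), zero_add,
    zero_add] at hdeg

/-- `F` is quadratic, so a factor `H` removed earlier reappears as `H ^ 2`; cancelling step by step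
therefore reduces the full iterate. -/
theorem PolyTriple.isDegreeSequence_of_reduced {α β γ : Fin 3 → ℂ} {d : ℕ → ℕ}
    (T : ℕ → PolyTriple) (h : ℕ → MvPolynomial (Fin 3) ℂ) (h0 : T 0 = fun i => X i)
    (hcomp : ∀ n, PolyTriple.comp (projMap α β γ) (T n) = fun i => h n * T (n + 1) i)
    (hh : ∀ n, h n ≠ 0) (hhom : ∀ n i, (T n i).IsHomogeneous (d n))
    (hcop : ∀ n p, Prime p → ¬ ∀ i, p ∣ T n i) :
    PolyTriple.IsDegreeSequence (projMap α β γ) d := by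
  have key : ∀ n, ∃ H : MvPolynomial (Fin 3) ℂ, H ≠ 0 ∧
      PolyTriple.iter (projMap α β γ) n = fun i => H * T n i := by
    intro n
    induction n with
    | zero => exact ⟨1, one_ne_zero, by simp [PolyTriple.iter, h0]⟩
    | succ n ih =>
      obtain ⟨H, hH, e⟩ := ih
      refine ⟨H ^ 2 * h n, mul_ne_zero (pow_ne_zero _ hH) (hh n), ?_⟩
      funext i
      rw [PolyTriple.iter, e, comp_projMap_smul, hcomp, mul_assoc]
  have hdeg : ∀ n, PolyTriple.HasDegree (PolyTriple.iter (projMap α β γ) n) (d n) := by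
    intro n
    obtain ⟨H, hH, e⟩ := key n
    exact ⟨H, T n, hH, fun i => congrFun e i, hhom n,
      fun R hR => isUnit_of_forall_prime_not_dvd (hcop n) hR⟩
  exact fun n k => ⟨fun hk => hk.unique (hdeg n), fun hk => hk ▸ hdeg n⟩

/-! ### Consequence of birationality -/

theorem exists_eval_ne_zero {v : MvPolynomial (Fin 2) ℂ} (hv : v ≠ 0) :
    ∃ z : Fin 2 → ℂ, eval z v ≠ 0 := by
  by_contra! h
  exact hv (MvPolynomial.funext fun z => by simp [h])

/-- Otherwise either the first coordinate of `f` is constant, against `f ∘ g = id`, or all three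
linear forms are constant along the direction `(α₂, -α₁)`, against injectivity. -/
theorem det_ne_zero_of_isBirational {α β γ : Fin 3 → ℂ} (hbir : (affineMap α β γ).IsBirational)
    (hαγ : α 1 * γ 2 - α 2 * γ 1 = 0) :
    α 1 * β 2 - α 2 * β 1 ≠ 0 := by
  intro hdet
  obtain ⟨g, v, hv, H⟩ := hbir
  by_cases hα : α 1 = 0 ∧ α 2 = 0
  · have hz : (X 0 - C (α 0)) * v = 0 := by
      refine MvPolynomial.funext fun z => ?_
      by_cases hvz : eval z v = 0
      · simp [hvz]
      · have := congrFun (H z hvz).2.2.2 0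
        simp [affineMap, PlaneRatMap.toFun, hα.1, hα.2] at this
        simp [← this]
    have hX : (X 0 - C (α 0) : MvPolynomial (Fin 2) ℂ) ≠ 0 := by
      intro h
      have := congrArg (eval fun _ => α 0 + 1) h
      simp at this
    exact (mul_ne_zero hX hv) hz
  · obtain ⟨z, hz⟩ := exists_eval_ne_zero hv
    have hcont : Continuous fun t : ℂ => eval (fun i => z i + t * ![α 2, -α 1] i) v := by
      refine (MvPolynomial.continuous_eval v).comp (by fun_prop)
    have hev : ∀ᶠ t in 𝓝[≠] (0 : ℂ), eval (fun i => z i + t * ![α 2, -α 1] i) v ≠ 0 :=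
      (hcont.continuousAt.eventually_ne (by simpa using hz)).filter_mono nhdsWithin_le_nhds
    obtain ⟨t, ht, ht0⟩ := (hev.and self_mem_nhdsWithin).exists
    have heq : (affineMap α β γ).toFun (fun i => z i + t * ![α 2, -α 1] i) =
        (affineMap α β γ).toFun z := by
      funext i
      fin_cases i
      · simp [affineMap, PlaneRatMap.toFun]; ring
      · simp only [affineMap, PlaneRatMap.toFun]
        simp
        congr 1
        · linear_combination (-t) * hdet
        · linear_combination (-t) * hαγ
    have h1 := (H _ ht).1.2.2
    rw [heq, (H z hz).1.2.2] at h1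
    have ht' : t ≠ 0 := ht0
    have h10 := congrFun h1 0
    have h11 := congrFun h1 1
    simp [ht'] at h10 h11
    exact hα ⟨h11, h10⟩

theorem not_forall_prime_dvd_X {p : MvPolynomial (Fin 3) ℂ} (hp : Prime p) :
    ¬ ∀ i, p ∣ (X i : MvPolynomial (Fin 3) ℂ) :=
  fun h => absurd (hp.dvd_X_unique (h 0) (h 1)) (by decide)

theorem PolyTriple.iter_projMap_isHomogeneous (α β γ : Fin 3 → ℂ) (n : ℕ) (i : Fin 3) :
    (PolyTriple.iter (projMap α β γ) n i).IsHomogeneous (2 ^ n) := by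
  induction n generalizing i with
  | zero => exact isHomogeneous_X ℂ i
  | succ n ih =>
    have hl := isHomogeneous_linEval ih
    rw [PolyTriple.iter, comp_projMap, pow_succ, mul_two]
    fin_cases i
    · exact (ih 0).mul (hl γ)
    · exact (hl α).mul (hl γ)
    · exact (ih 0).mul (hl β)

/-! ### All coefficients nonzero: no cancellation -/

section AllNonzero

variable {α β γ : Fin 3 → ℂ}

theorem iter_projMap_avoids (hαγ : α 1 * γ 2 - α 2 * γ 1 = 0)
    (hαβ : α 1 * β 2 - α 2 * β 1 ≠ 0) (n : ℕ) :
    AvoidsAffinePoints (PolyTriple.iter (projMap α β γ) n) := by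
  induction n with
  | zero => exact avoidsAffinePoints_X
  | succ n ih => exact ih.step hαγ hαβ (h := 1) (by simp [PolyTriple.iter]) (one_dvd _)

/-- On the line at infinity the iterates stay away from the point `[0 : γ₂ : -γ₁]`. -/
theorem iter_projMap_at_infinity (hα1 : α 1 ≠ 0) (hγ1 : γ 1 ≠ 0) (hγ2 : γ 2 ≠ 0)
    (hαγ : α 1 * γ 2 - α 2 * γ 1 = 0) (hαβ : α 1 * β 2 - α 2 * β 1 ≠ 0)
    (hβγ : β 1 * γ 2 - β 2 * γ 1 ≠ 0) (n : ℕ) {p : MvPolynomial (Fin 3) ℂ} (hp : Prime p)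
    (h0 : p ∣ PolyTriple.iter (projMap α β γ) n 0) :
    ¬ p ∣ C (γ 1) * PolyTriple.iter (projMap α β γ) n 1 +
      C (γ 2) * PolyTriple.iter (projMap α β γ) n 2 := by
  induction n with
  | zero =>
    intro h
    change p ∣ X 0 at h0
    change p ∣ C (γ 1) * X 1 + C (γ 2) * X 2 at h
    have := map_dvd (eval ![0, 1, 0]) ((hp.associated_X h0).symm.dvd.trans h)
    simp [hγ1] at this
  | succ n ih =>
    set T := PolyTriple.iter (projMap α β γ) n
    rw [PolyTriple.iter, comp_projMap] at h0 ⊢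
    change p ∣ T 0 * linEval γ T at h0
    change ¬ p ∣ C (γ 1) * (linEval α T * linEval γ T) + C (γ 2) * (T 0 * linEval β T)
    intro h
    -- If `T 0` vanishes modulo `p`, both `ℓ_α` and `ℓ_γ` become nonzero multiples of `γ₁x₁ + γ₂x₂`,
    -- and induction applies. Otherwise `ℓ_γ` vanishes on `T`, and `ℓ_β` would have to vanish as
    -- well, at an affine point.
    by_cases hT : p ∣ T 0
    · have hm := ih hT
      rw [dvd_add_left ((hT.mul_right _).mul_left _)] at h
      rcases hp.dvd_or_dvd (dvd_of_dvd_C_mul hγ1 h) with h | h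
      · refine hm (dvd_of_dvd_C_mul hα1 ?_)
        convert (h.sub (hT.mul_left (C (α 0)))).mul_left (C (γ 1)) using 1
        have : (C (α 1) * C (γ 2) : MvPolynomial (Fin 3) ℂ) = C (α 2) * C (γ 1) := by
          rw [← C_mul, ← C_mul, sub_eq_zero.1 hαγ]
        simp only [linEval]
        linear_combination T 2 * this
      · refine hm ?_
        convert h.sub (hT.mul_left (C (γ 0))) using 1
        simp only [linEval]; ring
    · have hγp := (hp.dvd_or_dvd h0).resolve_left hT
      rw [dvd_add_right ((hγp.mul_left _).mul_left _)] at h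
      have hβp := (hp.dvd_or_dvd (dvd_of_dvd_C_mul hγ2 h)).resolve_left hT
      exact hT ((iter_projMap_avoids hαγ hαβ n).dvd_of_dvd_linEval hβγ hp hβp hγp)

theorem isDegreeSequence_two_pow (hα1 : α 1 ≠ 0) (hγ1 : γ 1 ≠ 0) (hγ2 : γ 2 ≠ 0)
    (hαγ : α 1 * γ 2 - α 2 * γ 1 = 0) (hαβ : α 1 * β 2 - α 2 * β 1 ≠ 0)
    (hβγ : β 1 * γ 2 - β 2 * γ 1 ≠ 0) :
    PolyTriple.IsDegreeSequence (projMap α β γ) fun n => 2 ^ n :=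
  PolyTriple.isDegreeSequence_of_reduced (PolyTriple.iter (projMap α β γ)) (fun _ => 1) rfl
    (fun n => by simp [PolyTriple.iter]) (fun _ => one_ne_zero)
    (PolyTriple.iter_projMap_isHomogeneous α β γ)
    fun n _ hp h => iter_projMap_at_infinity hα1 hγ1 hγ2 hαγ hαβ hβγ n hp (h 0)
      (((h 1).mul_left _).add ((h 2).mul_left _))

end AllNonzero

/-! ### Case `α₁ = γ₁ = 0`: Fibonacci degrees -/

section SecondCoordinateBase

variable (α β γ : Fin 3 → ℂ)

/-- When `α₁ = γ₁ = 0`, the `n`-th iterate has the second coordinate `(fracSeq n).2 / (fracSeq n).1`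
and the first coordinate `α₀ + α₂ y` with `y` the second coordinate of the previous iterate. -/
noncomputable def fracSeq : ℕ → MvPolynomial (Fin 3) ℂ × MvPolynomial (Fin 3) ℂ
  | 0 => (X 0, X 2)
  | 1 => (linForm γ, linForm β)
  | n + 2 =>
    ((C (γ 0) * (fracSeq (n + 1)).1 + C (γ 2) * (fracSeq (n + 1)).2) * (fracSeq n).1,
      C (β 0) * ((fracSeq (n + 1)).1 * (fracSeq n).1) +
        C (β 1) * ((C (α 0) * (fracSeq n).1 + C (α 2) * (fracSeq n).2) * (fracSeq (n + 1)).1) +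
        C (β 2) * ((fracSeq (n + 1)).2 * (fracSeq n).1))

/-- The iterates `Fⁿ⁺¹` without common factors, when `α₁ = γ₁ = 0`. -/
noncomputable def fracTriple (n : ℕ) : PolyTriple :=
  ![(fracSeq α β γ (n + 1)).1 * (fracSeq α β γ n).1,
    (C (α 0) * (fracSeq α β γ n).1 + C (α 2) * (fracSeq α β γ n).2) * (fracSeq α β γ (n + 1)).1,
    (fracSeq α β γ (n + 1)).2 * (fracSeq α β γ n).1]

theorem fracSeq_isHomogeneous (n : ℕ) :
    (fracSeq α β γ n).1.IsHomogeneous (Nat.fib (n + 1)) ∧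
      (fracSeq α β γ n).2.IsHomogeneous (Nat.fib (n + 1)) := by
  induction n using Nat.twoStepInduction with
  | zero => exact ⟨isHomogeneous_X _ _, isHomogeneous_X _ _⟩
  | one =>
    have := isHomogeneous_linEval (T := fun i => X i) (k := 1) fun i => isHomogeneous_X _ _
    exact ⟨this γ, this β⟩
  | more n h0 h1 =>
    have hm (c e : ℂ) := ((isHomogeneous_C_mul h1.1 c).add (isHomogeneous_C_mul h1.2 e)).mul h0.1
    have hn (c e : ℂ) := ((isHomogeneous_C_mul h0.1 c).add (isHomogeneous_C_mul h0.2 e)).mul h1.1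
    have hfib : Nat.fib (n + 2 + 1) = Nat.fib (n + 1) + Nat.fib (n + 1 + 1) := Nat.fib_add_two
    rw [add_comm (Nat.fib (n + 1))] at hfib
    constructor
    · rw [hfib]; exact hm _ _
    · refine ((isHomogeneous_C_mul ?_ _).add (isHomogeneous_C_mul ?_ _)).add
        (isHomogeneous_C_mul ?_ _)
      · rw [hfib]; exact h1.1.mul h0.1
      · rw [hfib, add_comm (Nat.fib (n + 1 + 1))]; exact hn _ _
      · rw [hfib]; exact h1.2.mul h0.1

theorem fracTriple_isHomogeneous (n : ℕ) (i : Fin 3) :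
    (fracTriple α β γ n i).IsHomogeneous (Nat.fib (n + 3)) := by
  have h0 := fracSeq_isHomogeneous α β γ n
  have h1 := fracSeq_isHomogeneous α β γ (n + 1)
  have hfib : Nat.fib (n + 3) = Nat.fib (n + 1) + Nat.fib (n + 1 + 1) := Nat.fib_add_two
  fin_cases i
  · rw [hfib, add_comm]; exact h1.1.mul h0.1
  · rw [hfib]
    exact ((isHomogeneous_C_mul h0.1 _).add (isHomogeneous_C_mul h0.2 _)).mul h1.1
  · rw [hfib, add_comm]; exact h1.2.mul h0.1

variable {α β γ}

theorem comp_fracTriple (hα1 : α 1 = 0) (hγ1 : γ 1 = 0) (n : ℕ) :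
    PolyTriple.comp (projMap α β γ) (fracTriple α β γ n) =
      fun i => (fracSeq α β γ n).1 * fracTriple α β γ (n + 1) i := by
  rw [comp_projMap]
  funext i
  fin_cases i <;> simp [fracTriple, fracSeq, linEval, hα1, hγ1] <;> ring

theorem fracTriple_zero (hα1 : α 1 = 0) :
    PolyTriple.comp (projMap α β γ) (fun i => X i) = fracTriple α β γ 0 := by
  rw [comp_projMap]
  funext i
  fin_cases i <;> simp [fracTriple, fracSeq, linEval, linForm, hα1] <;> ring

theorem fracTriple_avoids (hα1 : α 1 = 0) (hγ1 : γ 1 = 0)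
    (hαβ : α 1 * β 2 - α 2 * β 1 ≠ 0) (n : ℕ) :
    AvoidsAffinePoints (fracTriple α β γ n) := by
  have hαγ : α 1 * γ 2 - α 2 * γ 1 = 0 := by simp [hα1, hγ1]
  induction n with
  | zero =>
    exact avoidsAffinePoints_X.step hαγ hαβ (h := 1)
      (by simp [fracTriple_zero hα1]) (one_dvd _)
  | succ n ih =>
    exact ih.step hαγ hαβ (comp_fracTriple hα1 hγ1 n)
      ((Dvd.intro_left _ rfl : _ ∣ (fracSeq α β γ (n + 2)).1).mul_right _)

theorem linEval_γ_fracTriple (hγ1 : γ 1 = 0) (n : ℕ) :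
    linEval γ (fracTriple α β γ n) = (fracSeq α β γ (n + 2)).1 := by
  simp [fracTriple, fracSeq, linEval, hγ1]; ring

theorem linEval_β_fracTriple (n : ℕ) :
    linEval β (fracTriple α β γ n) = (fracSeq α β γ (n + 2)).2 := by
  simp [fracTriple, fracSeq, linEval]

theorem fracSeq_coprime (hα1 : α 1 = 0) (hγ1 : γ 1 = 0) (hγ2 : γ 2 ≠ 0)
    (hαβ : α 1 * β 2 - α 2 * β 1 ≠ 0) (n : ℕ) {p : MvPolynomial (Fin 3) ℂ} (hp : Prime p) :
    (p ∣ (fracSeq α β γ n).1 → ¬ p ∣ (fracSeq α β γ n).2) ∧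
      (p ∣ (fracSeq α β γ (n + 1)).1 → ¬ p ∣ (fracSeq α β γ (n + 1)).2) ∧
      (p ∣ (fracSeq α β γ (n + 1)).1 → ¬ p ∣ (fracSeq α β γ n).1) := by
  have hα2 : α 2 ≠ 0 := fun h => hαβ (by simp [hα1, h])
  have hβ1 : β 1 ≠ 0 := fun h => hαβ (by simp [hα1, h])
  have hβγ : β 1 * γ 2 - β 2 * γ 1 ≠ 0 := by simp [hγ1, hβ1, hγ2]
  induction n with
  | zero =>
    have h02 : p ∣ X 0 → ¬ p ∣ X 2 := fun h h' => absurd (hp.dvd_X_unique h h') (by decide)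
    have hγ0 : p ∣ linForm γ → ¬ p ∣ X 0 := by
      intro h h'
      refine h02 h' (dvd_of_dvd_C_mul hγ2 ?_)
      convert h.sub (h'.mul_left (C (γ 0))) using 1
      simp [linForm, hγ1]
    exact ⟨h02, fun h h' => hγ0 h (avoidsAffinePoints_X.dvd_of_dvd_linEval hβγ hp h' h), hγ0⟩
  | succ n ih =>
    obtain ⟨ih0, ih1, ih10⟩ := ih
    have hD : p ∣ (fracSeq α β γ (n + 2)).1 → ¬ p ∣ (fracSeq α β γ (n + 1)).1 := by
      intro h h'
      rcases hp.dvd_or_dvd h with h | h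
      · rw [dvd_add_right (h'.mul_left _)] at h
        exact ih1 h' (dvd_of_dvd_C_mul hγ2 h)
      · exact ih10 h' h
    refine ⟨ih1, fun h h' => ?_, hD⟩
    have hT : p ∣ (fracSeq α β γ (n + 1)).1 * (fracSeq α β γ n).1 :=
      (fracTriple_avoids hα1 hγ1 hαβ n).dvd_of_dvd_linEval hβγ hp
        (linEval_β_fracTriple n ▸ h') (linEval_γ_fracTriple hγ1 n ▸ h)
    -- Modulo such a `p` the new numerator reduces to `β₁ α₂` times the numerator at `n` times the
    -- denominator at `n + 1`, none of which vanishes.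
    have h0 := (hp.dvd_or_dvd hT).resolve_left (hD h)
    change p ∣ _ + _ + _ at h'
    rw [dvd_add_left ((h0.mul_left _).mul_left _), dvd_add_right ((h0.mul_left _).mul_left _)]
      at h'
    have h2 := (hp.dvd_or_dvd (dvd_of_dvd_C_mul hβ1 h')).resolve_right (hD h)
    rw [dvd_add_right (h0.mul_left _)] at h2
    exact ih0 h0 (dvd_of_dvd_C_mul hα2 h2)

theorem linForm_ne_zero (hγ2 : γ 2 ≠ 0) : linForm γ ≠ 0 := by
  intro h
  have := congrArg (eval ![0, 0, 1]) h
  simp [linForm, hγ2] at this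

theorem not_isUnit_linForm (γ : Fin 3 → ℂ) : ¬ IsUnit (linForm γ) := by
  intro h
  have := h.map (eval (0 : Fin 3 → ℂ))
  simp [linForm] at this

/-- Being a nonunit is what drives the induction: it supplies a prime factor of the previous
denominator, which would divide the numerator too if the new denominator were zero. -/
theorem fracSeq_ne_zero_and_not_isUnit (hα1 : α 1 = 0) (hγ1 : γ 1 = 0) (hγ2 : γ 2 ≠ 0)
    (hαβ : α 1 * β 2 - α 2 * β 1 ≠ 0) (n : ℕ) :
    (fracSeq α β γ n).1 ≠ 0 ∧ ¬ IsUnit (fracSeq α β γ n).1 := by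
  induction n using Nat.twoStepInduction with
  | zero => exact ⟨X_ne_zero _, X_prime.not_isUnit⟩
  | one => exact ⟨linForm_ne_zero hγ2, not_isUnit_linForm γ⟩
  | more n h0 h1 =>
    refine ⟨mul_ne_zero (fun h => ?_) h0.1, fun h => h0.2 (isUnit_of_mul_isUnit_right h)⟩
    obtain ⟨p, hp, hpD⟩ := WfDvdMonoid.exists_irreducible_factor h1.2 h1.1
    refine (fracSeq_coprime hα1 hγ1 hγ2 hαβ (n + 1) hp.prime).1 hpD (dvd_of_dvd_C_mul hγ2 ?_)
    rw [← dvd_add_right (hpD.mul_left (C (γ 0))), h]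
    exact dvd_zero p

theorem isDegreeSequence_fib (hα1 : α 1 = 0) (hγ1 : γ 1 = 0) (hγ2 : γ 2 ≠ 0)
    (hαβ : α 1 * β 2 - α 2 * β 1 ≠ 0) :
    PolyTriple.IsDegreeSequence (projMap α β γ) fun n => Nat.fib (n + 2) := by
  have hα2 : α 2 ≠ 0 := fun h => hαβ (by simp [hα1, h])
  refine PolyTriple.isDegreeSequence_of_reduced
    -- `fracTriple` starts at the first iterate, so the identity is prepended; the first composition
    -- cancels nothing.
    (fun n => n.casesOn (fun i => X i) (fracTriple α β γ))
    (fun n => n.casesOn 1 fun n => (fracSeq α β γ n).1) rfl ?_ ?_ ?_ ?_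
  · rintro (_ | n)
    · simp [fracTriple_zero hα1]
    · exact comp_fracTriple hα1 hγ1 n
  · rintro (_ | n)
    · exact one_ne_zero
    · exact (fracSeq_ne_zero_and_not_isUnit hα1 hγ1 hγ2 hαβ n).1
  · rintro (_ | n) i
    · exact isHomogeneous_X _ _
    · exact fracTriple_isHomogeneous α β γ n i
  · rintro (_ | n) p hp h
    · exact not_forall_prime_dvd_X hp h
    · obtain ⟨h0, h1, h10⟩ := fracSeq_coprime hα1 hγ1 hγ2 hαβ n hp
      by_cases hd : p ∣ (fracSeq α β γ (n + 1)).1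
      · exact (hp.dvd_or_dvd (h 2)).elim (h1 hd) (h10 hd)
      · have hd0 := (hp.dvd_or_dvd (h 0)).resolve_left hd
        have := (hp.dvd_or_dvd (h 1)).resolve_right hd
        rw [dvd_add_right (hd0.mul_left _)] at this
        exact h0 hd0 (dvd_of_dvd_C_mul hα2 this)

end SecondCoordinateBase

/-! ### Case `α₂ = γ₂ = 0`: linear degrees -/

section FirstCoordinateBase

variable (α β γ : Fin 3 → ℂ)

/-- When `α₂ = γ₂ = 0`, the `n`-th iterate has the first coordinate `Ξ / x₀` with `Ξ` this form. -/
noncomputable def baseSeq : ℕ → MvPolynomial (Fin 3) ℂ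
  | 0 => X 1
  | n + 1 => C (α 0) * X 0 + C (α 1) * baseSeq n

/-- When `α₂ = γ₂ = 0`, the common denominator of the `n`-th iterate, up to a power of `x₀`. -/
noncomputable def denSeq : ℕ → MvPolynomial (Fin 3) ℂ
  | 0 => 1
  | n + 1 => denSeq n * (C (γ 0) * X 0 + C (γ 1) * baseSeq α n)

/-- When `α₂ = γ₂ = 0`, the numerator of the second coordinate of the `n`-th iterate. -/
noncomputable def numSeq : ℕ → MvPolynomial (Fin 3) ℂ
  | 0 => X 2
  | n + 1 => X 0 * (C (β 0) * (X 0 * denSeq α γ n) + C (β 1) * (baseSeq α n * denSeq α γ n) +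
      C (β 2) * numSeq n)

/-- The iterates `Fⁿ` without common factors, when `α₂ = γ₂ = 0`. -/
noncomputable def fiberedTriple (n : ℕ) : PolyTriple :=
  ![X 0 * denSeq α γ n, baseSeq α n * denSeq α γ n, numSeq α β γ n]

theorem baseSeq_isHomogeneous (n : ℕ) : (baseSeq α n).IsHomogeneous 1 := by
  induction n with
  | zero => exact isHomogeneous_X _ _
  | succ n ih =>
    exact (isHomogeneous_C_mul (isHomogeneous_X _ _) _).add (isHomogeneous_C_mul ih _)

theorem denSeq_isHomogeneous (n : ℕ) : (denSeq α γ n).IsHomogeneous n := by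
  induction n with
  | zero => exact isHomogeneous_one _ _
  | succ n ih =>
    exact ih.mul ((isHomogeneous_C_mul (isHomogeneous_X _ _) _).add
      (isHomogeneous_C_mul (baseSeq_isHomogeneous α n) _))

theorem fiberedTriple_isHomogeneous (n : ℕ) (i : Fin 3) :
    (fiberedTriple α β γ n i).IsHomogeneous (n + 1) := by
  have hD := denSeq_isHomogeneous α γ n
  have h0 : (X 0 * denSeq α γ n).IsHomogeneous (n + 1) :=
    add_comm 1 n ▸ (isHomogeneous_X _ _).mul hD
  have h1 : (baseSeq α n * denSeq α γ n).IsHomogeneous (n + 1) :=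
    add_comm 1 n ▸ (baseSeq_isHomogeneous α n).mul hD
  have h2 : (numSeq α β γ n).IsHomogeneous (n + 1) := by
    clear hD h0 h1
    induction n with
    | zero => exact isHomogeneous_X _ _
    | succ n ih =>
      have hD := denSeq_isHomogeneous α γ n
      rw [add_comm (n + 1) 1]
      refine (isHomogeneous_X _ _).mul (((isHomogeneous_C_mul ?_ _).add
        (isHomogeneous_C_mul ?_ _)).add (isHomogeneous_C_mul ih _))
      · exact add_comm 1 n ▸ (isHomogeneous_X _ _).mul hD
      · exact add_comm 1 n ▸ (baseSeq_isHomogeneous α n).mul hD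
  fin_cases i
  exacts [h0, h1, h2]

variable {α β γ}

theorem comp_fiberedTriple (hα2 : α 2 = 0) (hγ2 : γ 2 = 0) (n : ℕ) :
    PolyTriple.comp (projMap α β γ) (fiberedTriple α β γ n) =
      fun i => denSeq α γ n * fiberedTriple α β γ (n + 1) i := by
  rw [comp_projMap]
  funext i
  fin_cases i <;> simp [fiberedTriple, baseSeq, denSeq, numSeq, linEval, hα2, hγ2] <;> ring

theorem fiberedTriple_zero : fiberedTriple α β γ 0 = fun i => X i := by
  funext i
  fin_cases i <;> simp [fiberedTriple, baseSeq, denSeq, numSeq]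

theorem fiberedTriple_avoids (hα2 : α 2 = 0) (hγ2 : γ 2 = 0)
    (hαβ : α 1 * β 2 - α 2 * β 1 ≠ 0) (n : ℕ) :
    AvoidsAffinePoints (fiberedTriple α β γ n) := by
  induction n with
  | zero => exact fiberedTriple_zero (α := α) (β := β) (γ := γ) ▸ avoidsAffinePoints_X
  | succ n ih =>
    exact ih.step (by simp [hα2, hγ2]) hαβ (comp_fiberedTriple hα2 hγ2 n)
      ((dvd_mul_right _ _).mul_left _)

theorem not_dvd_baseSeq (hα1 : α 1 ≠ 0) {p : MvPolynomial (Fin 3) ℂ} (hp : Prime p)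
    (h0 : p ∣ X 0) (n : ℕ) : ¬ p ∣ baseSeq α n := by
  induction n with
  | zero => exact fun h => absurd (hp.dvd_X_unique h0 h) (by decide)
  | succ n ih =>
    intro h
    rw [baseSeq, dvd_add_right (h0.mul_left _)] at h
    exact ih (dvd_of_dvd_C_mul hα1 h)

theorem not_dvd_denSeq (hα1 : α 1 ≠ 0) (hγ1 : γ 1 ≠ 0) {p : MvPolynomial (Fin 3) ℂ}
    (hp : Prime p) (h0 : p ∣ X 0) (n : ℕ) : ¬ p ∣ denSeq α γ n := by
  induction n with
  | zero => exact fun h => hp.not_isUnit (isUnit_of_dvd_one h)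
  | succ n ih =>
    intro h
    have := (hp.dvd_or_dvd h).resolve_left ih
    rw [dvd_add_right (h0.mul_left _)] at this
    exact not_dvd_baseSeq hα1 hp h0 n (dvd_of_dvd_C_mul hγ1 this)

theorem denSeq_coprime_numSeq (hα2 : α 2 = 0) (hγ2 : γ 2 = 0) (hγ1 : γ 1 ≠ 0)
    (hαβ : α 1 * β 2 - α 2 * β 1 ≠ 0) (n : ℕ) {p : MvPolynomial (Fin 3) ℂ} (hp : Prime p)
    (hD : p ∣ denSeq α γ n) : ¬ p ∣ numSeq α β γ n := by
  have hα1 : α 1 ≠ 0 := fun h => hαβ (by simp [hα2, h])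
  have hβ2 : β 2 ≠ 0 := fun h => hαβ (by simp [hα2, h])
  have hβγ : β 1 * γ 2 - β 2 * γ 1 ≠ 0 := by simp [hγ2, hβ2, hγ1]
  induction n with
  | zero => exact absurd (isUnit_of_dvd_one hD) hp.not_isUnit
  | succ n ih =>
    intro hN
    -- On `x₀ = 0` the denominator is a nonzero multiple of a power of `x₁`.
    have h0 : ¬ p ∣ X 0 := fun h => not_dvd_denSeq hα1 hγ1 hp h _ hD
    have hN' := (hp.dvd_or_dvd hN).resolve_left h0
    have hDn : p ∣ X 0 * denSeq α γ n := by
      refine (fiberedTriple_avoids hα2 hγ2 hαβ n).dvd_of_dvd_linEval hβγ hp hN' ?_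
      convert hD using 1
      simp [linEval, fiberedTriple, denSeq, hγ2]; ring
    have hd := (hp.dvd_or_dvd hDn).resolve_left h0
    rw [dvd_add_right (((hd.mul_left _).mul_left _).add ((hd.mul_left _).mul_left _))] at hN'
    exact ih hd (dvd_of_dvd_C_mul hβ2 hN')

theorem isDegreeSequence_linear (hα2 : α 2 = 0) (hγ2 : γ 2 = 0) (hγ1 : γ 1 ≠ 0)
    (hαβ : α 1 * β 2 - α 2 * β 1 ≠ 0) :
    PolyTriple.IsDegreeSequence (projMap α β γ) fun n => n + 1 := by
  have hα1 : α 1 ≠ 0 := fun h => hαβ (by simp [hα2, h])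
  refine PolyTriple.isDegreeSequence_of_reduced (fiberedTriple α β γ) (denSeq α γ)
    fiberedTriple_zero (comp_fiberedTriple hα2 hγ2) (fun n h => ?_)
    (fiberedTriple_isHomogeneous α β γ) (fun n p hp h => ?_)
  · exact not_dvd_denSeq hα1 hγ1 (X_prime (i := (0 : Fin 3))) dvd_rfl n (h ▸ dvd_zero _)
  · by_cases hD : p ∣ denSeq α γ n
    · exact denSeq_coprime_numSeq hα2 hγ2 hγ1 hαβ n hp hD (h 2)
    · exact not_dvd_baseSeq hα1 hp ((hp.dvd_or_dvd (h 0)).resolve_right hD) n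
        ((hp.dvd_or_dvd (h 1)).resolve_right hD)

end FirstCoordinateBase

/-! ### Limits of `n`-th roots -/

section Growth

theorem tendsto_two_pow_root :
    Tendsto (fun n : ℕ => ((2 ^ n : ℕ) : ℝ) ^ ((1 : ℝ) / (n : ℝ))) atTop (𝓝 2) := by
  refine tendsto_const_nhds.congr' ?_
  filter_upwards [eventually_ne_atTop 0] with n hn
  push_cast
  rw [one_div, Real.pow_rpow_inv_natCast zero_le_two hn]

theorem tendsto_succ_root :
    Tendsto (fun n : ℕ => ((n + 1 : ℕ) : ℝ) ^ ((1 : ℝ) / (n : ℝ))) atTop (𝓝 1) := by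
  -- With `x = n + 1`, the exponent `1 / (x - 1)` is `1 / n`.
  have h := (tendsto_rpow_div_mul_add 1 1 (-1) zero_ne_one).comp
    (tendsto_natCast_atTop_atTop.comp (tendsto_add_atTop_nat 1))
  refine h.congr fun n => ?_
  simp

theorem goldenRatio_pow_le_fib (n : ℕ) :
    Real.goldenRatio ^ n ≤ Nat.fib (n + 2) ∧
      (Nat.fib (n + 2) : ℝ) ≤ Real.goldenRatio ^ (n + 1) := by
  have h1 := Real.one_lt_goldenRatio
  have h2 := Real.goldenRatio_lt_two
  have hsq := Real.goldenRatio_sq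
  induction n using Nat.twoStepInduction with
  | zero => simpa using h1.le
  | one => norm_num [Nat.fib_add_two]; exact ⟨h2.le, by linarith⟩
  | more n ih0 ih1 =>
    have hf : (Nat.fib (n + 2 + 2) : ℝ) = Nat.fib (n + 2) + Nat.fib (n + 1 + 2) := by
      exact_mod_cast (Nat.fib_add_two (n := n + 2))
    have e (k : ℕ) : Real.goldenRatio ^ (k + 2) =
        Real.goldenRatio ^ k + Real.goldenRatio ^ (k + 1) := by
      rw [pow_add, hsq]; ring
    rw [hf, e n, e (n + 1)]
    exact ⟨add_le_add ih0.1 ih1.1, add_le_add ih0.2 ih1.2⟩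

theorem tendsto_fib_root :
    Tendsto (fun n : ℕ => (Nat.fib (n + 2) : ℝ) ^ ((1 : ℝ) / (n : ℝ))) atTop
      (𝓝 Real.goldenRatio) := by
  have h0 := Real.goldenRatio_pos
  have hroot : Tendsto (fun n : ℕ => Real.goldenRatio * Real.goldenRatio ^ ((1 : ℝ) / (n : ℝ)))
      atTop (𝓝 Real.goldenRatio) := by
    have h := (Real.continuousAt_const_rpow h0.ne' (b := 0)).tendsto.comp
      tendsto_one_div_atTop_nhds_zero_nat
    simpa using h.const_mul Real.goldenRatio
  refine tendsto_of_tendsto_of_tendsto_of_le_of_le' tendsto_const_nhds hroot ?_ ?_ <;>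
    filter_upwards [eventually_ne_atTop 0] with n hn
  · calc Real.goldenRatio = (Real.goldenRatio ^ n) ^ ((1 : ℝ) / (n : ℝ)) := by
          rw [one_div, Real.pow_rpow_inv_natCast h0.le hn]
      _ ≤ _ := Real.rpow_le_rpow (by positivity) (goldenRatio_pow_le_fib n).1 (by positivity)
  · calc _ ≤ (Real.goldenRatio ^ (n + 1)) ^ ((1 : ℝ) / (n : ℝ)) :=
          Real.rpow_le_rpow (by positivity) (goldenRatio_pow_le_fib n).2 (by positivity)
      _ = _ := by
          rw [pow_succ, Real.mul_rpow (by positivity) h0.le, one_div,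
            Real.pow_rpow_inv_natCast h0.le hn]

end Growth

/-! ### The three cases combined -/

theorem theorem3p2 (α β γ : Fin 3 → ℂ)
    (hγ : (γ 1, γ 2) ≠ (0, 0))
    (hbir : (affineMap α β γ).IsBirational)
    (hαγ : α 1 * γ 2 - α 2 * γ 1 = 0) :
    ∃ d : ℕ → ℕ, PolyTriple.IsDegreeSequence (projMap α β γ) d ∧
      (α 1 ≠ 0 ∧ α 2 ≠ 0 ∧ γ 1 ≠ 0 ∧ γ 2 ≠ 0 →
        PolyTriple.IsDynamicalDegree (projMap α β γ) 2 ∧ ∀ n, d n = 2 ^ n) ∧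
      (α 1 = 0 ∧ γ 1 = 0 →
        PolyTriple.IsDynamicalDegree (projMap α β γ) ((1 + Real.sqrt 5) / 2) ∧
          ∀ n, d (n + 2) = d (n + 1) + d n) ∧
      (α 2 = 0 ∧ γ 2 = 0 →
        PolyTriple.IsDynamicalDegree (projMap α β γ) 1 ∧ ∀ n, d n = n + 1) := by
  have hαβ := det_ne_zero_of_isBirational hbir hαγ
  have hα : ¬ (α 1 = 0 ∧ α 2 = 0) := fun h => hαβ (by simp [h.1, h.2])
  by_cases hγ1 : γ 1 = 0
  · have hγ2 : γ 2 ≠ 0 := fun h => hγ (by simp [hγ1, h])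
    have hα1 : α 1 = 0 := by simpa [hγ1, hγ2] using hαγ
    have hd := isDegreeSequence_fib hα1 hγ1 hγ2 hαβ
    refine ⟨_, hd, fun h => absurd hγ1 h.2.2.1, fun _ => ⟨⟨_, hd, tendsto_fib_root⟩, fun n => ?_⟩,
      fun h => absurd h.2 hγ2⟩
    rw [Nat.fib_add_two (n := n + 2), add_comm]
  by_cases hγ2 : γ 2 = 0
  · have hα2 : α 2 = 0 := by simpa [hγ1, hγ2] using hαγ
    have hd := isDegreeSequence_linear hα2 hγ2 hγ1 hαβ
    exact ⟨_, hd, fun h => absurd hγ2 h.2.2.2, fun h => absurd h.2 hγ1,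
      fun _ => ⟨⟨_, hd, tendsto_succ_root⟩, fun _ => rfl⟩⟩
  have hα1 : α 1 ≠ 0 := fun h => hα ⟨h, by simpa [h, hγ1] using hαγ⟩
  -- `γ` is a nonzero multiple of `α` in its linear part, so this determinant is nonzero with that
  -- of `α` and `β`.
  have hβγ : β 1 * γ 2 - β 2 * γ 1 ≠ 0 := by
    intro h
    have : γ 1 * (α 1 * β 2 - α 2 * β 1) = 0 := by
      linear_combination (-α 1) * h + β 1 * hαγ
    exact (mul_ne_zero hγ1 hαβ) this
  have hd := isDegreeSequence_two_pow hα1 hγ1 hγ2 hαγ hαβ hβγ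
  exact ⟨_, hd, fun _ => ⟨⟨_, hd, tendsto_two_pow_root⟩, fun _ => rfl⟩,
    fun h => absurd h.2 hγ1, fun h => absurd h.2 hγ2⟩
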